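/- Let $B$ be a unital commutative semisimple complex Banach algebra whose maximal ideal space $X$ (the set of characters of $B$, with the weak-$*$ topology) is connected, and write $\hat f(x)=x(f)$ for $f\in B$, $x\in X$. Let $T:B\to B$ be an endomorphism (a bounded linear map with $T(fg)=(Tf)(Tg)$) induced by a selfmap $\phi$ of $X$, i.e. $\widehat{Tf}(x)=\hat f(\phi(x))$ for all $f\in B$, $x\in X$. Suppose that $T$ is a Riesz operator, that is: (a) for each complex $\lambda\neq 0$, $\lambda-T$ is open as a map onto its range; (b) for each $\lambda\ne 0$, the range $R(\lambda-T)$ is closed; (c) for each $\lambda\ne 0$, $\dim N(\lambda-T)$ and $\operatorname{codim} R(\lambda-T)$ are finite and equal, where $N$ denotes the null space; (d) for each $\lambda\ne 0$, the lengths of the chains $N((\lambda-T)^k)$ and $R((\lambda-T)^k)$, $k=0,1,2,\dots$, i.e. the least $k$ at which the $k$-th and $(k+1)$-st members of the chain coincide, are finite and equal; (e) the non-zero points of the spectrum of $T$ are eigenvalues, and if there are infinitely many of them, they form a sequence tending to $0$. Let $\phi_n$ be the $n$-th iterate of $\phi$ and suppose that $\bigcap_{n=0}^{\infty}\phi_n(X)=\{x_0\}$.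 If $B$ has no non-zero point derivation at $x_0$, i.e. the only linear functional $D:B\to\mathbb{C}$ (not assumed continuous) with $D(fg)=\hat f(x_0)D(g)+\hat g(x_0)D(f)$ for all $f,g\in B$ is $D=0$, then there is a positive integer $N$ such that $T^N f=\hat f(x_0)\,1$ for all $f\in B$. -/

import Mathlib

open Filter Topology WeakDual

/-- A Riesz operator on a complex Banach space: a bounded operator `T` for which every `μ - T`,
`μ ≠ 0`, is (relatively) open with closed range, has kernel and cokernel of the same finite
dimension, and has null chain and image chain of the same finite length; moreover the non-zero
spectrum of `T` consists of eigenvalues which, if infinite in number, form a sequence tending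
to `0`. -/
structure IsRieszOperator {E : Type*} [NormedAddCommGroup E] [NormedSpace ℂ E]
    (T : E →L[ℂ] E) : Prop where
  /-- `μ - T` is open as a map onto its range (openness as a map into all of `E` would force it to
  be surjective, so that already the identity of `ℂ` would not be a Riesz operator). -/
  isOpenMap : ∀ μ : ℂ, μ ≠ 0 → IsOpenMap (Set.rangeFactorization (μ • (1 : E →L[ℂ] E) - T))
  isClosed_range : ∀ μ : ℂ, μ ≠ 0 → IsClosed (Set.range (μ • (1 : E →L[ℂ] E) - T))
  finite_ker : ∀ μ : ℂ, μ ≠ 0 →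
    FiniteDimensional ℂ (LinearMap.ker (μ • (1 : E →ₗ[ℂ] E) - T.toLinearMap))
  finite_coker : ∀ μ : ℂ, μ ≠ 0 →
    FiniteDimensional ℂ (E ⧸ LinearMap.range (μ • (1 : E →ₗ[ℂ] E) - T.toLinearMap))
  finrank_ker_eq : ∀ μ : ℂ, μ ≠ 0 →
    Module.finrank ℂ (LinearMap.ker (μ • (1 : E →ₗ[ℂ] E) - T.toLinearMap)) =
      Module.finrank ℂ (E ⧸ LinearMap.range (μ • (1 : E →ₗ[ℂ] E) - T.toLinearMap))
  /-- The least `k` with `N((μ - T)^k) = N((μ - T)^(k+1))` and the least `k` with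
  `R((μ - T)^k) = R((μ - T)^(k+1))` both exist, and they coincide. -/
  chain_length : ∀ μ : ℂ, μ ≠ 0 → ∃ p : ℕ,
    IsLeast {k : ℕ | LinearMap.ker ((μ • (1 : E →ₗ[ℂ] E) - T.toLinearMap) ^ k) =
      LinearMap.ker ((μ • (1 : E →ₗ[ℂ] E) - T.toLinearMap) ^ (k + 1))} p ∧
    IsLeast {k : ℕ | LinearMap.range ((μ • (1 : E →ₗ[ℂ] E) - T.toLinearMap) ^ k) =
      LinearMap.range ((μ • (1 : E →ₗ[ℂ] E) - T.toLinearMap) ^ (k + 1))} p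
  hasEigenvalue : ∀ μ ∈ spectrum ℂ T, μ ≠ 0 → Module.End.HasEigenvalue T.toLinearMap μ
  tendsto_zero : (spectrum ℂ T \ {0}).Infinite →
    ∃ u : ℕ → ℂ, Function.Injective u ∧ Set.range u = spectrum ℂ T \ {0} ∧
      Tendsto u atTop (𝓝 0)

/-- A point derivation at a character `x` of `B`: a linear functional `D` on `B`, not assumed to be
continuous, with `D (f g) = x f * D g + x g * D f`. -/
def IsPointDerivation {B : Type*} [NormedCommRing B] [NormedAlgebra ℂ B]
    (x : characterSpace ℂ B) (D : B →ₗ[ℂ] ℂ) : Prop :=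
  ∀ f g : B, D (f * g) = x f * D g + x g * D f

/-- `T` is induced by the selfmap `φ` of the maximal ideal space, that is, the Gelfand transform
of `T f` is that of `f` composed with `φ`. -/
def IsInducedBy {B : Type*} [NormedCommRing B] [NormedAlgebra ℂ B] [CompleteSpace B]
    (T : B →L[ℂ] B) (φ : characterSpace ℂ B → characterSpace ℂ B) : Prop :=
  ∀ (f : B) (x : characterSpace ℂ B),
    gelfandTransform ℂ B (T f) x = gelfandTransform ℂ B f (φ x)

/-! Let `M` be the kernel of `x₀`, `P` the projection onto it along the constants, and `S = T P`.
Since `T` fixes `1` and preserves `M`, the claim is that `S` is nilpotent. An eigenfunction in `M`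
with eigenvalue of modulus at least one does not shrink along orbits of `φ`, yet these close in on
`x₀`, where it vanishes; so it is zero. The Riesz conditions promote this injectivity to
invertibility, so the spectrum of `S` lies in the open disc and `‖S ^ n‖` tends to `0`. Without
point derivations, each `h` in `M` is a finite sum of products `f * g` from `M`, and
multiplicativity gives `‖S ^ n h‖ ≤ C_h ‖S ^ n‖ ^ 2`. If no power vanished, uniform boundedness
would give `‖S ^ n‖ ≤ C ‖S ^ n‖ ^ 2`, so `‖S ^ n‖` would stay away from `0`. -/

/-! ### Characters and eigenfunctions -/

section Semisimple

variable {B : Type*} [NormedCommRing B] [NormedAlgebra ℂ B] [CompleteSpace B]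

/-- In a semisimple algebra the characters separate points. -/
theorem eq_of_forall_character_eq (hB : Ring.jacobson B = ⊥) {f g : B}
    (h : ∀ x : characterSpace ℂ B, x f = x g) : f = g := by
  rw [← sub_eq_zero, ← Submodule.mem_bot (R := B), ← hB]
  refine Submodule.mem_sInf.2 fun (I : Ideal B) hI => ?_
  by_contra hfI
  have hmax : Ideal.IsMaximal I := ⟨hI⟩
  have hmem : ∀ a ∈ I, I.toCharacterSpace a = 0 := fun a ha =>
    I.toCharacterSpace_apply_eq_zero_of_mem ha
  obtain ⟨y, z, hz, hyz⟩ := hmax.exists_inv hfI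
  have h1 := congrArg I.toCharacterSpace hyz
  rw [map_add, map_mul, map_sub, h, sub_self, mul_zero, zero_add, hmem z hz, map_one] at h1
  exact zero_ne_one h1

variable {T : B →L[ℂ] B} {φ : characterSpace ℂ B → characterSpace ℂ B}
  {x₀ : characterSpace ℂ B}

theorem IsInducedBy.apply_map (hφ : IsInducedBy T φ) (f : B) (x : characterSpace ℂ B) :
    x (T f) = φ x f :=
  hφ f x

theorem IsInducedBy.continuous (hφ : IsInducedBy T φ) : Continuous φ := by
  refine Continuous.subtype_mk (f := fun x => (φ x : WeakDual ℂ B)) ?_ fun x => (φ x).2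
  refine WeakDual.continuous_of_continuous_eval fun f => ?_
  have : (fun x => (φ x : WeakDual ℂ B) f) = gelfandTransform ℂ B (T f) :=
    funext fun x => (hφ f x).symm
  rw [this]
  exact (gelfandTransform ℂ B (T f)).continuous

theorem IsInducedBy.map_one (hB : Ring.jacobson B = ⊥) (hφ : IsInducedBy T φ) : T 1 = 1 :=
  eq_of_forall_character_eq hB fun x => by rw [hφ.apply_map, _root_.map_one, _root_.map_one]

/-- `φ` maps the intersection of the iterated images into itself, because it commutes with its
iterates. -/
theorem map_eq_self_of_iInter_iterate_eq {X : Type*} {φ : X → X} {x₀ : X}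
    (hx₀ : ⋂ n : ℕ, φ^[n] '' Set.univ = {x₀}) : φ x₀ = x₀ := by
  have h : φ x₀ ∈ ⋂ n : ℕ, φ^[n] '' Set.univ := by
    have hmem : x₀ ∈ ⋂ n : ℕ, φ^[n] '' Set.univ := hx₀ ▸ rfl
    refine Set.mem_iInter.2 fun n => ?_
    obtain ⟨y, -, hy⟩ := Set.mem_iInter.1 hmem n
    exact ⟨φ y, trivial, by rw [← hy, ← Function.iterate_succ_apply, Function.iterate_succ_apply']⟩
  rwa [hx₀] at h

/-- An eigenfunction of `f ↦ f ∘ φ` for an eigenvalue of modulus at least one vanishes if it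
vanishes at the point to which the iterates of `φ` shrink the space. -/
theorem eq_zero_of_comp_eq_smul {X : Type*} [TopologicalSpace X] [CompactSpace X] [T2Space X]
    {φ : X → X} (hφ : Continuous φ) {x₀ : X} (hx₀ : ⋂ n : ℕ, φ^[n] '' Set.univ = {x₀})
    {F : X → ℂ} (hF : Continuous F) (hF₀ : F x₀ = 0) {μ : ℂ} (hμ : 1 ≤ ‖μ‖)
    (h : ∀ x, F (φ x) = μ * F x) (x : X) : F x = 0 := by
  by_contra hx
  have hit : ∀ n : ℕ, ‖F x‖ ≤ ‖F (φ^[n] x)‖ := by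
    intro n
    induction n with
    | zero => simp
    | succ n ih =>
      rw [Function.iterate_succ_apply', h, norm_mul]
      nlinarith [norm_nonneg (F (φ^[n] x))]
  have hcl : IsClosed {y | ‖F x‖ ≤ ‖F y‖} := isClosed_le continuous_const hF.norm
  have hcl' : ∀ n : ℕ, IsClosed (φ^[n] '' Set.univ) := fun n =>
    (isCompact_univ.image (hφ.iterate n)).isClosed
  -- These nested compact sets are nonempty, the `n`-th containing `φ^[n] x`; a common point can
  -- only be `x₀`, where `F` vanishes.
  obtain ⟨y, hy⟩ := IsCompact.nonempty_iInter_of_sequence_nonempty_isCompact_isClosed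
    (fun n : ℕ => φ^[n] '' Set.univ ∩ {y | ‖F x‖ ≤ ‖F y‖})
    (fun n => Set.inter_subset_inter_left _ (by
      rintro _ ⟨z, -, rfl⟩
      exact ⟨φ z, trivial, by rw [Function.iterate_succ_apply]⟩))
    (fun n => ⟨φ^[n] x, ⟨x, trivial, rfl⟩, hit n⟩)
    ((hcl' 0).inter hcl).isCompact (fun n => (hcl' n).inter hcl)
  rw [Set.mem_iInter] at hy
  have hy₀ : y = x₀ := by
    have : y ∈ ⋂ n : ℕ, φ^[n] '' Set.univ := Set.mem_iInter.2 fun n => (hy n).1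
    rwa [hx₀] at this
  have := (hy 0).2
  rw [Set.mem_ofPred_eq, hy₀, hF₀, norm_zero] at this
  exact hx (norm_le_zero_iff.1 this)

theorem eq_zero_of_eigenvector (hB : Ring.jacobson B = ⊥) (hφ : IsInducedBy T φ)
    (hx₀ : ⋂ n : ℕ, φ^[n] '' Set.univ = {x₀}) {μ : ℂ} (hμ : 1 ≤ ‖μ‖) {f : B}
    (hf : T f = μ • f) (hf₀ : x₀ f = 0) : f = 0 := by
  refine eq_of_forall_character_eq hB fun x => ?_
  rw [map_zero]
  refine eq_zero_of_comp_eq_smul hφ.continuous hx₀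
    (gelfandTransform ℂ B f).continuous hf₀ hμ (fun y => ?_) x
  rw [← hφ, hf, map_smul, ContinuousMap.smul_apply, smul_eq_mul]

end Semisimple

/-! ### Point derivations and the square of the maximal ideal -/

section PointDerivation

variable {B : Type*} [NormedCommRing B] [NormedAlgebra ℂ B] {x₀ : characterSpace ℂ B}

/-- If there is no non-zero point derivation at `x₀`, every element of the maximal ideal `ker x₀`
is a finite sum of products of pairs of its elements. -/
theorem mem_span_mul_of_no_pointDerivation
    (hder : ∀ D : B →ₗ[ℂ] ℂ, IsPointDerivation x₀ D → D = 0) {h : B} (hh : x₀ h = 0) :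
    h ∈ Submodule.span ℂ {k : B | ∃ f g : B, x₀ f = 0 ∧ x₀ g = 0 ∧ f * g = k} := by
  set W := Submodule.span ℂ {k : B | ∃ f g : B, x₀ f = 0 ∧ x₀ g = 0 ∧ f * g = k} with hW
  have hW₀ : ∀ w ∈ W, x₀ w = 0 := by
    intro w hw
    induction hw using Submodule.span_induction with
    | mem x hx =>
      obtain ⟨f, g, hf, -, rfl⟩ := hx
      rw [map_mul, hf, zero_mul]
    | zero => exact map_zero _
    | add x y _ _ hx hy => rw [map_add, hx, hy, add_zero]
    | smul a x _ hx => rw [map_smul, hx, smul_zero]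
  by_contra hhW
  -- Adjoining `1` makes the separating functional vanish on constants, as a derivation must. The
  -- separation is purely algebraic, so `D` need not be continuous.
  have hnot : h ∉ W ⊔ Submodule.span ℂ {(1 : B)} := by
    rw [Submodule.mem_sup]
    rintro ⟨w, hw, z, hz, hwz⟩
    obtain ⟨c, rfl⟩ := Submodule.mem_span_singleton.1 hz
    have hc := congrArg x₀ hwz
    rw [map_add, hW₀ w hw, map_smul, map_one, hh, zero_add, smul_eq_mul, mul_one] at hc
    rw [hc, zero_smul, add_zero] at hwz
    exact hhW (hwz ▸ hw)
  obtain ⟨D, hDh, hD⟩ := Submodule.exists_le_ker_of_notMem hnot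
  have hD₁ : D 1 = 0 :=
    hD (Submodule.mem_sup_right (Submodule.mem_span_singleton_self 1))
  refine hDh ?_
  rw [hder D ?_, LinearMap.zero_apply]
  intro f g
  have hfg : f * g = (f - x₀ f • 1) * (g - x₀ g • 1) + x₀ f • g + x₀ g • f
      - (x₀ f * x₀ g) • (1 : B) := by
    simp only [Algebra.smul_def, map_mul, mul_one]
    ring
  have hvan : ∀ f : B, x₀ (f - x₀ f • 1) = 0 := fun f => by
    rw [map_sub, map_smul, map_one, smul_eq_mul, mul_one, sub_self]
  have hD₂ : D ((f - x₀ f • 1) * (g - x₀ g • 1)) = 0 :=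
    hD (Submodule.mem_sup_left (Submodule.subset_span ⟨_, _, hvan f, hvan g, rfl⟩))
  rw [hfg, map_sub, map_add, map_add, hD₂, map_smul, map_smul, map_smul, hD₁]
  simp

end PointDerivation

/-! ### Riesz operators and spectral radius -/

/-- If `T` is a Riesz operator and `μ ≠ 0` is not an eigenvalue, then `μ - T` is surjective. -/
theorem IsRieszOperator.range_eq_top_of_ker_eq_bot {E : Type*} [NormedAddCommGroup E] [NormedSpace ℂ E]
    {T : E →L[ℂ] E} (hT : IsRieszOperator T) {μ : ℂ} (hμ : μ ≠ 0)
    (hker : LinearMap.ker (μ • (1 : E →ₗ[ℂ] E) - T.toLinearMap) = ⊥) :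
    LinearMap.range (μ • (1 : E →ₗ[ℂ] E) - T.toLinearMap) = ⊤ := by
  have := hT.finite_coker μ hμ
  have h := hT.finrank_ker_eq μ hμ
  rw [hker, finrank_bot] at h
  exact Submodule.Quotient.subsingleton_iff.1 (Module.finrank_zero_iff.1 h.symm)

/-- In a complex Banach algebra, an element whose spectrum lies in the open unit disc has powers
tending to zero. -/
theorem tendsto_norm_pow_zero_of_spectrum_lt_one {A : Type*} [NormedRing A] [NormedAlgebra ℂ A]
    [CompleteSpace A] [Nontrivial A] {a : A} (ha : ∀ z ∈ spectrum ℂ a, ‖z‖ < 1) :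
    Tendsto (fun n : ℕ => ‖a ^ n‖) atTop (𝓝 0) := by
  have hr : spectralRadius ℂ a < (1 : NNReal) :=
    spectrum.spectralRadius_lt_of_forall_lt a fun z hz => by
      rw [← NNReal.coe_lt_coe]; simpa using ha z hz
  have ht := spectrum.pow_nnnorm_pow_one_div_tendsto_nhds_spectralRadius a
  obtain ⟨r, hr₁, hr₂⟩ := ENNReal.lt_iff_exists_nnreal_btwn.1 hr
  have hr₂' : r < 1 := by exact_mod_cast hr₂
  have hev : ∀ᶠ n : ℕ in atTop, ‖a ^ n‖ ≤ (r : ℝ) ^ n := by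
    filter_upwards [ht.eventually_lt_const hr₁, eventually_gt_atTop 0] with n hn hn0
    have hn0' : (0 : ℝ) < n := by exact_mod_cast hn0
    have := ENNReal.rpow_le_rpow hn.le hn0'.le
    rw [← ENNReal.rpow_mul, one_div_mul_cancel hn0'.ne', ENNReal.rpow_one,
      ENNReal.rpow_natCast] at this
    have h' : ‖a ^ n‖₊ ≤ r ^ n := by exact_mod_cast this
    exact_mod_cast h'
  exact squeeze_zero' (Eventually.of_forall fun _ => norm_nonneg _) hev
    (tendsto_pow_atTop_nhds_zero_of_lt_one r.2 (by exact_mod_cast hr₂'))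

/-! ### Nilpotency on the maximal ideal -/

section Main

variable {B : Type*} [NormedCommRing B] [NormedAlgebra ℂ B]

/-- The continuous projection `f ↦ f - f̂(x₀) 1` onto the kernel of the character `x₀`. -/
noncomputable def characterKerProj (x₀ : characterSpace ℂ B) : B →L[ℂ] B :=
  1 - (CharacterSpace.toCLM x₀).smulRight (1 : B)

variable {x₀ : characterSpace ℂ B}

theorem characterKerProj_apply (f : B) : characterKerProj x₀ f = f - x₀ f • (1 : B) := rfl

theorem apply_characterKerProj (f : B) : x₀ (characterKerProj x₀ f) = 0 := by
  rw [characterKerProj_apply, map_sub, map_smul, map_one, smul_eq_mul, mul_one, sub_self]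

theorem characterKerProj_of_apply_eq_zero {f : B} (hf : x₀ f = 0) :
    characterKerProj x₀ f = f := by
  rw [characterKerProj_apply, hf, zero_smul, sub_zero]

variable {T : B →L[ℂ] B}

/-- `T` preserves the kernel of `x₀`, on which the projection is the identity, so only the rightmost
projection matters. The exponent must be positive, since `S ^ 0` contains no projection. -/
theorem mul_characterKerProj_pow_apply (hx : ∀ f, x₀ (T f) = x₀ f) (n : ℕ) (f : B) :
    ((T * characterKerProj x₀) ^ (n + 1)) f = (T ^ (n + 1)) (characterKerProj x₀ f) := by
  induction n generalizing f with
  | zero => simp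
  | succ n ih =>
    rw [pow_succ, mul_apply_eq_comp, ih, pow_succ T (n + 1),
      mul_apply_eq_comp, mul_apply_eq_comp,
      characterKerProj_of_apply_eq_zero (f := T _) (by rw [hx, apply_characterKerProj])]

variable [CompleteSpace B]

/-- On the kernel of `x₀`, the spectrum of the endomorphism lies in the open unit disc. -/
theorem norm_lt_one_of_mem_spectrum_mul_characterKerProj (hB : Ring.jacobson B = ⊥)
    (hT : IsRieszOperator T) {φ : characterSpace ℂ B → characterSpace ℂ B}
    (hφ : IsInducedBy T φ) (hx₀ : ⋂ n : ℕ, φ^[n] '' Set.univ = {x₀}) :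
    ∀ μ ∈ spectrum ℂ (T * characterKerProj x₀), ‖μ‖ < 1 := by
  intro μ hμ
  by_contra! hlt
  refine hμ ?_
  have hμ0 : μ ≠ 0 := norm_pos_iff.1 (zero_lt_one.trans_le hlt)
  have hx : ∀ f, x₀ (T f) = x₀ f := fun f => by
    rw [hφ.apply_map, map_eq_self_of_iInter_iterate_eq hx₀]
  have hT₁ : T 1 = 1 := hφ.map_one hB
  have hmemker : ∀ f, f ∈ LinearMap.ker (μ • (1 : B →ₗ[ℂ] B) - T.toLinearMap) ↔ T f = μ • f :=
    fun f => by
      rw [LinearMap.mem_ker]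
      exact sub_eq_zero.trans eq_comm
  -- The case `μ = 1` is separate, as `1` is then an eigenvector on `B`: there the kernel is the
  -- line of constants, so the range has codimension one and, lying in the kernel of `x₀`, equals
  -- it.
  have hsurj : ∀ g, x₀ g = 0 → ∃ f, x₀ f = 0 ∧ μ • f - T f = g := by
    intro g hg
    by_cases hμ1 : μ = 1
    · have hker : LinearMap.ker (μ • (1 : B →ₗ[ℂ] B) - T.toLinearMap)
          = Submodule.span ℂ {(1 : B)} := by
        ext f
        rw [hmemker, Submodule.mem_span_singleton]
        constructor
        · intro hf
          have heig : T (characterKerProj x₀ f) = μ • characterKerProj x₀ f := by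
            rw [characterKerProj_apply, map_sub, map_smul, hT₁, hf, hμ1, one_smul, one_smul]
          exact ⟨x₀ f, (sub_eq_zero.1 (eq_zero_of_eigenvector hB hφ hx₀ hlt heig
            (apply_characterKerProj f))).symm⟩
        · rintro ⟨c, rfl⟩
          rw [map_smul, hT₁, hμ1, one_smul]
      set R := LinearMap.range (μ • (1 : B →ₗ[ℂ] B) - T.toLinearMap) with hR
      have hR₀ : ∀ f ∈ R, x₀ f = 0 := by
        rintro _ ⟨f, rfl⟩
        change x₀ (μ • f - T f) = 0
        rw [map_sub, map_smul, hx, hμ1, one_smul, sub_self]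
      have h1ne : (1 : B) ≠ 0 := fun h => zero_ne_one (α := ℂ) (by
        rw [← map_zero x₀, ← h, map_one])
      have hrank : Module.finrank ℂ (B ⧸ R) = 1 := by
        rw [← hT.finrank_ker_eq μ hμ0, hker, finrank_span_singleton h1ne]
      have hmk : (Submodule.Quotient.mk 1 : B ⧸ R) ≠ 0 := fun h => by
        have := hR₀ 1 ((Submodule.Quotient.mk_eq_zero R).1 h)
        rw [map_one] at this
        exact one_ne_zero this
      obtain ⟨c, hc⟩ := exists_smul_eq_of_finrank_eq_one hrank hmk (Submodule.Quotient.mk g)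
      have hcg : c • (1 : B) - g ∈ R := (Submodule.Quotient.eq R).1 hc
      have hc0 := hR₀ _ hcg
      rw [map_sub, map_smul, hg, map_one, sub_zero, smul_eq_mul, mul_one] at hc0
      rw [hc0, zero_smul, zero_sub, Submodule.neg_mem_iff] at hcg
      obtain ⟨f, hf⟩ := hcg
      have hf' : μ • f - T f = g := hf
      refine ⟨characterKerProj x₀ f, apply_characterKerProj f, ?_⟩
      rw [characterKerProj_apply, map_sub, map_smul, hT₁, ← hf', hμ1, one_smul, one_smul,
        sub_sub_sub_cancel_right]
    · have hker : LinearMap.ker (μ • (1 : B →ₗ[ℂ] B) - T.toLinearMap) = ⊥ := by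
        refine (Submodule.eq_bot_iff _).2 fun f hf => ?_
        rw [hmemker] at hf
        refine eq_zero_of_eigenvector hB hφ hx₀ hlt hf ?_
        have := congrArg x₀ hf
        rw [hx, map_smul, smul_eq_mul] at this
        by_contra h0
        exact hμ1 (mul_right_cancel₀ h0 (by rw [one_mul]; exact this.symm))
      obtain ⟨f, hf⟩ : g ∈ LinearMap.range (μ • (1 : B →ₗ[ℂ] B) - T.toLinearMap) :=
        hT.range_eq_top_of_ker_eq_bot hμ0 hker ▸ Submodule.mem_top
      have hf' : μ • f - T f = g := hf
      refine ⟨f, ?_, hf'⟩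
      have := congrArg x₀ hf'
      rw [map_sub, map_smul, hx, hg, smul_eq_mul, ← sub_one_mul] at this
      exact (mul_eq_zero.1 this).resolve_left (sub_ne_zero.2 hμ1)
  have happ : ∀ f, (algebraMap ℂ (B →L[ℂ] B) μ - T * characterKerProj x₀) f
      = μ • f - T (characterKerProj x₀ f) := fun f => by
    rw [Algebra.algebraMap_eq_smul_one]; rfl
  refine ContinuousLinearMap.isUnit_iff_bijective.2 ?_
  refine ⟨(injective_iff_map_eq_zero _).2 fun f hf => ?_, fun g => ?_⟩
  · rw [happ] at hf
    have h0 := congrArg x₀ hf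
    rw [map_sub, map_smul, hx, apply_characterKerProj, sub_zero, map_zero, smul_eq_mul] at h0
    have hf0 := (mul_eq_zero.1 h0).resolve_left hμ0
    rw [characterKerProj_of_apply_eq_zero hf0] at hf
    exact eq_zero_of_eigenvector hB hφ hx₀ hlt (sub_eq_zero.1 hf).symm hf0
  · obtain ⟨f, hf0, hf⟩ := hsurj _ (apply_characterKerProj (x₀ := x₀) g)
    -- `T * characterKerProj x₀` kills `1`, so the added constant contributes exactly the part `x₀ g
    -- • 1` of `g`.
    refine ⟨f + (μ⁻¹ * x₀ g) • 1, ?_⟩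
    have h1 : characterKerProj x₀ (1 : B) = 0 := by
      rw [characterKerProj_apply, map_one, one_smul, sub_self]
    rw [happ, map_add, map_smul, h1, smul_zero, add_zero, characterKerProj_of_apply_eq_zero hf0,
      smul_add, smul_smul, mul_inv_cancel_left₀ hμ0, add_sub_right_comm, hf,
      characterKerProj_apply, sub_add_cancel]

/-- If the powers of a multiplicative operator tend to zero on an idempotent maximal ideal, one of
them vanishes there. -/
theorem exists_pow_characterKerProj_eq_zero (hmul : ∀ f g : B, T (f * g) = T f * T g)
    (hx : ∀ f, x₀ (T f) = x₀ f)
    (hder : ∀ D : B →ₗ[ℂ] ℂ, IsPointDerivation x₀ D → D = 0)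
    (ht : Tendsto (fun n : ℕ => ‖(T * characterKerProj x₀) ^ n‖) atTop (𝓝 0)) :
    ∃ n : ℕ, (T * characterKerProj x₀) ^ (n + 1) = 0 := by
  by_contra! hne
  have hmul' : ∀ (n : ℕ) (f g : B), (T ^ n) (f * g) = (T ^ n) f * (T ^ n) g := by
    intro n
    induction n with
    | zero => simp
    | succ n ih =>
      intro f g
      simp only [pow_succ, mul_apply_eq_comp, hmul, ih]
  set S := T * characterKerProj x₀ with hS
  -- The square comes from the two factors of each product; `C` depends on `h`.
  have hbd : ∀ h : B, x₀ h = 0 → ∃ C, ∀ n : ℕ, ‖(T ^ (n + 1)) h‖ ≤ C * ‖S ^ (n + 1)‖ ^ 2 := by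
    intro h hh
    have hmem := mem_span_mul_of_no_pointDerivation hder hh
    clear hh
    induction hmem using Submodule.span_induction with
    | mem x hx' =>
      obtain ⟨f, g, hf, hg, rfl⟩ := hx'
      have hle : ∀ (n : ℕ) (f : B), x₀ f = 0 → ‖(T ^ (n + 1)) f‖ ≤ ‖S ^ (n + 1)‖ * ‖f‖ := by
        intro n f hf
        have := (S ^ (n + 1)).le_opNorm f
        rwa [mul_characterKerProj_pow_apply hx, characterKerProj_of_apply_eq_zero hf] at this
      refine ⟨‖f‖ * ‖g‖, fun n => ?_⟩
      rw [hmul']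
      calc ‖(T ^ (n + 1)) f * (T ^ (n + 1)) g‖
          ≤ ‖(T ^ (n + 1)) f‖ * ‖(T ^ (n + 1)) g‖ := norm_mul_le _ _
        _ ≤ (‖S ^ (n + 1)‖ * ‖f‖) * (‖S ^ (n + 1)‖ * ‖g‖) := by
          gcongr
          exacts [hle n f hf, hle n g hg]
        _ = ‖f‖ * ‖g‖ * ‖S ^ (n + 1)‖ ^ 2 := by ring
    | zero => exact ⟨0, by simp⟩
    | add x y hx' hy' ihx ihy =>
      obtain ⟨C, hC⟩ := ihx
      obtain ⟨C', hC'⟩ := ihy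
      refine ⟨C + C', fun n => ?_⟩
      rw [map_add, add_mul]
      exact norm_add_le_of_le (hC n) (hC' n)
    | smul a x hx' ih =>
      obtain ⟨C, hC⟩ := ih
      refine ⟨‖a‖ * C, fun n => ?_⟩
      rw [map_smul, norm_smul, mul_assoc]
      exact mul_le_mul_of_nonneg_left (hC n) (norm_nonneg a)
  -- Dividing by `‖S ^ (n + 1)‖ ^ 2`, nonzero by assumption, gives a pointwise bounded family, so
  -- `C` becomes uniform.
  obtain ⟨C, hC⟩ := banach_steinhaus
    (g := fun n : ℕ => ((((‖S ^ (n + 1)‖ : ℝ) ^ 2)⁻¹ : ℝ) : ℂ) • S ^ (n + 1)) (fun h => by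
      obtain ⟨C, hC⟩ := hbd _ (apply_characterKerProj (x₀ := x₀) h)
      refine ⟨C, fun n => ?_⟩
      have hpos : 0 < ‖S ^ (n + 1)‖ ^ 2 := pow_pos (norm_pos_iff.2 (hne n)) 2
      rw [_root_.smul_apply, norm_smul, Complex.norm_real, norm_inv,
        Real.norm_of_nonneg hpos.le, inv_mul_le_iff₀ hpos, mul_comm,
        mul_characterKerProj_pow_apply hx]
      exact hC n)
  have hle : ∀ n : ℕ, 1 ≤ C * ‖S ^ (n + 1)‖ := by
    intro n
    have hpos : 0 < ‖S ^ (n + 1)‖ := norm_pos_iff.2 (hne n)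
    have := hC n
    rw [norm_smul, Complex.norm_real, norm_inv, Real.norm_of_nonneg (pow_pos hpos 2).le,
      inv_mul_le_iff₀ (pow_pos hpos 2)] at this
    nlinarith
  have hlim := ((tendsto_add_atTop_iff_nat 1).2 ht).const_mul C
  rw [mul_zero] at hlim
  exact absurd (ge_of_tendsto' hlim hle) (by norm_num)

end Main

/-- Let `B` be a unital commutative semisimple complex Banach algebra with connected maximal ideal
space `X` (the characters of `B` with the weak-star topology), and `T` a Riesz endomorphism of `B`
induced by `φ : X → X`, with `⋂ n, φ^[n] (X) = {x₀}`. If `B` has no non-zero point derivation at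
`x₀`, then some power `T ^ N`, `N ≥ 1`, is `f ↦ f̂(x₀) 1`. -/
theorem corollary1p4 {B : Type*} [NormedCommRing B] [NormedAlgebra ℂ B] [CompleteSpace B]
    (hB : Ring.jacobson B = ⊥) (hX : ConnectedSpace (characterSpace ℂ B))
    (T : B →L[ℂ] B) (hmul : ∀ f g : B, T (f * g) = T f * T g) (hT : IsRieszOperator T)
    (φ : characterSpace ℂ B → characterSpace ℂ B) (hφ : IsInducedBy T φ)
    (x₀ : characterSpace ℂ B) (hx₀ : ⋂ n : ℕ, φ^[n] '' Set.univ = {x₀})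
    (hder : ∀ D : B →ₗ[ℂ] ℂ, IsPointDerivation x₀ D → D = 0) :
    ∃ N : ℕ, 0 < N ∧ ∀ f : B, (T ^ N) f = gelfandTransform ℂ B f x₀ • (1 : B) := by
  have : Nontrivial B := ⟨0, 1, fun h => zero_ne_one (α := ℂ) (by
    rw [← map_zero x₀, h, map_one])⟩
  have hx : ∀ f, x₀ (T f) = x₀ f := fun f => by
    rw [hφ.apply_map, map_eq_self_of_iInter_iterate_eq hx₀]
  have hT₁ : T 1 = 1 := hφ.map_one hB
  have hTn₁ : ∀ n : ℕ, (T ^ n) 1 = 1 := by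
    intro n
    induction n with
    | zero => rfl
    | succ n ih => rw [pow_succ, mul_apply_eq_comp, hT₁, ih]
  obtain ⟨n, hn⟩ := exists_pow_characterKerProj_eq_zero hmul hx hder
    (tendsto_norm_pow_zero_of_spectrum_lt_one
      (norm_lt_one_of_mem_spectrum_mul_characterKerProj hB hT hφ hx₀))
  refine ⟨n + 1, n.succ_pos, fun f => ?_⟩
  have h := mul_characterKerProj_pow_apply hx n f
  rw [hn, _root_.zero_apply, characterKerProj_apply, map_sub, map_smul, hTn₁] at h
  exact (sub_eq_zero.1 h.symm)
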